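/- Let $S^1=\{z\in\mathbb C : |z|=1\}$. For $m\ge 1$, $\vec s=(s_1,\dots,s_m)\in\mathbb Z_{\ge1}^m$ and $\vec b=(b_1,\dots,b_m)\in(S^1)^m$ with $(s_1,b_1)\ne(1,1)$, define the multiple polylogarithm value $$\lambda\binom{\vec s}{\vec b}=\sum_{n_1>\cdots>n_m\ge1}\frac{(1/b_1)^{n_1}(b_1/b_2)^{n_2}\cdots(b_{m-1}/b_m)^{n_m}}{n_1^{s_1}\cdots n_m^{s_m}},$$ the sum being the limit, as $N\to\infty$, of the partial sums over $N\ge n_1>\cdots>n_m\ge1$. Let $k,\ell\ge1$ be integers and write $[n]=\{1,\dots,n\}$. Let $\mathcal I_{k,\ell}$ be the set of pairs $(\varphi,\psi)$ of order preserving injective maps $\varphi:[k]\to[k+\ell]$, $\psi:[\ell]\to[k+\ell]$ such that $[k+\ell]$ is the disjoint union of $\operatorname{im}\varphi$ and $\operatorname{im}\psi$. For vectors $\vec a$ of length $k$ and $\vec b$ of length $\ell$, let $\vec a\sqcup\!\sqcup_{(\varphi,\psi)}\vec b$ be the vector of length $k+\ell$ whose $i$-th entry is $a_j$ if $i=\varphi(j)$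 and $b_j$ if $i=\psi(j)$. For $\vec r\in\mathbb Z_{\ge1}^k$, $\vec s\in\mathbb Z_{\ge1}^\ell$ and $\vec t\in\mathbb Z_{\ge1}^{k+\ell}$ with $|\vec t|=|\vec r|+|\vec s|$ (where $|\cdot|$ denotes the sum of the entries), put $h=\vec r\sqcup\!\sqcup_{(\varphi,\psi)}\vec s$ and $$c^{\vec t,(\varphi,\psi)}_{\vec r,\vec s}(i)=\begin{cases}\binom{t_i-1}{h_i-1}&\text{if } i=1,\text{ or } i-1,i\in\operatorname{im}\varphi,\text{ or } i-1,i\in\operatorname{im}\psi,\\[4pt] \binom{t_i-1}{\sum_{j=1}^i t_j-\sum_{j=1}^i h_j}&\text{otherwise,}\end{cases}$$ where $\binom{n}{m}=0$ unless $0\le m\le n$. Let $\vec r\in\mathbb Z_{\ge1}^k$, $\vec s\in\mathbb Z_{\ge1}^\ell$, $\vec a\in(S^1)^k$, $\vec b\in(S^1)^\ell$ with $(r_1,a_1)\ne(1,1)$ and $(s_1,b_1)\ne(1,1)$. Then the series defining $\lambda\binom{\vec r}{\vec a}$ and $\lambda\binom{\vec s}{\vec b}$ converge; for all $\vec t$ and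 $(\varphi,\psi)$ as above with $\prod_i c^{\vec t,(\varphi,\psi)}_{\vec r,\vec s}(i)\neq0$, the first entries of $\vec t$ and of $\vec a\sqcup\!\sqcup_{(\varphi,\psi)}\vec b$ are not both $1$ and the series defining $\lambda\binom{\vec t}{\vec a\sqcup\!\sqcup_{(\varphi,\psi)}\vec b}$ converges; and $$\lambda\binom{\vec r}{\vec a}\,\lambda\binom{\vec s}{\vec b}=\sum_{\substack{\vec t\in\mathbb Z_{\ge1}^{k+\ell}\\|\vec t|=|\vec r|+|\vec s|}}\ \sum_{(\varphi,\psi)\in\mathcal I_{k,\ell}}\Big(\prod_{i=1}^{k+\ell}c^{\vec t,(\varphi,\psi)}_{\vec r,\vec s}(i)\Big)\,\lambda\binom{\vec t}{\vec a\sqcup\!\sqcup_{(\varphi,\psi)}\vec b},$$ where terms with coefficient $0$ are taken to be $0$. -/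

import Mathlib

open Filter Topology

noncomputable section

namespace MPV

/-- The map `θ(b₁, …, b_k) = (1 / b₁, b₁ / b₂, …, b_{k-1} / b_k)`. -/
def theta {G : Type*} [CommGroup G] {k : ℕ} (b : Fin k → G) (i : Fin k) : G :=
  (if i.val = 0 then 1 else b ⟨i.val - 1, by omega⟩) / b i

open Classical in
/-- The partial sum, over `N ≥ n₁ > ⋯ > n_k ≥ 1`, of
`(z₁ ^ n₁ ⋯ z_k ^ n_k) / (n₁ ^ s₁ ⋯ n_k ^ s_k)`. -/
def liPartial {k : ℕ} (s : Fin k → ℕ) (z : Fin k → ℂ) (N : ℕ) : ℂ :=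
  ∑ n ∈ (Fintype.piFinset fun _ : Fin k => Finset.Icc 1 N) with StrictAnti n,
    ∏ i, z i ^ n i / (n i : ℂ) ^ s i

/-- The partial sum, over `N ≥ n₁ > ⋯ > n_k ≥ 1`, of the series defining `λ(s; b)`:
the terms are
`((1 / b₁) ^ n₁ (b₁ / b₂) ^ n₂ ⋯ (b_{k-1} / b_k) ^ n_k) / (n₁ ^ s₁ ⋯ n_k ^ s_k)`. -/
def lambdaPartial {k : ℕ} (s : Fin k → ℕ) (b : Fin k → Circle) (N : ℕ) : ℂ :=
  liPartial s (fun i => ((theta b i : Circle) : ℂ)) N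

/-- The multiple polylogarithm value `λ(s; b)`. The series need not converge absolutely; its
value is the limit of the partial sums over `n₁ ≤ N`. -/
def lambda {k : ℕ} (s : Fin k → ℕ) (b : Fin k → Circle) : ℂ :=
  limUnder atTop (lambdaPartial s b)

/-- The series defining `λ(s; b)` converges to the number `lambda s b`. -/
def LambdaConverges {k : ℕ} (s : Fin k → ℕ) (b : Fin k → Circle) : Prop :=
  Tendsto (lambdaPartial s b) atTop (𝓝 (lambda s b))

/-- The condition `(s₁, b₁) ≠ (1, 1)`. -/
def IsAdmissible {k : ℕ} (hk : 0 < k) (s : Fin k → ℕ) (b : Fin k → Circle) : Prop :=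
  (s ⟨0, hk⟩, b ⟨0, hk⟩) ≠ (1, 1)

open Classical in
/-- The set of pairs `(φ, ψ)` of order preserving injective maps `φ : [k] → [k + l]` and
`ψ : [l] → [k + l]` such that `[k + l]` is the disjoint union of their images. -/
def shufflePairs (k l : ℕ) :
    Finset ((Fin k → Fin (k + l)) × (Fin l → Fin (k + l))) :=
  {p | StrictMono p.1 ∧ StrictMono p.2 ∧
    Disjoint (Set.range p.1) (Set.range p.2) ∧ Set.range p.1 ∪ Set.range p.2 = Set.univ}

/-- The vector whose `i`-th entry is `a j` if `i = φ j` and `b j` if `i = ψ j`. -/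
def shuffleVec {α : Type*} [One α] {k l : ℕ} (φ : Fin k → Fin (k + l)) (ψ : Fin l → Fin (k + l))
    (a : Fin k → α) (b : Fin l → α) : Fin (k + l) → α :=
  Function.extend φ a (Function.extend ψ b 1)

theorem shuffleVec_left {α : Type*} [One α] {k l : ℕ} {φ : Fin k → Fin (k + l)}
    {ψ : Fin l → Fin (k + l)} (h : (φ, ψ) ∈ shufflePairs k l) (a : Fin k → α) (b : Fin l → α)
    (j : Fin k) : shuffleVec φ ψ a b (φ j) = a j := by
  simp only [shufflePairs, Finset.mem_filter] at h
  exact h.2.1.injective.extend_apply _ _ _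

theorem shuffleVec_right {α : Type*} [One α] {k l : ℕ} {φ : Fin k → Fin (k + l)}
    {ψ : Fin l → Fin (k + l)} (h : (φ, ψ) ∈ shufflePairs k l) (a : Fin k → α) (b : Fin l → α)
    (j : Fin l) : shuffleVec φ ψ a b (ψ j) = b j := by
  simp only [shufflePairs, Finset.mem_filter] at h
  have hj : ¬ ∃ i, φ i = ψ j := fun hi =>
    Set.disjoint_left.mp h.2.2.2.1 hi ⟨j, rfl⟩
  rw [shuffleVec, Function.extend_apply' _ _ _ hj]
  exact h.2.2.1.injective.extend_apply _ _ _

/-- The binomial coefficient `n` over `m` for an integer `m`, which is `0` when `m < 0`. -/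
def intChoose (n : ℕ) (m : ℤ) : ℕ :=
  if 0 ≤ m then n.choose m.toNat else 0

open Classical in
/-- The factor `c_{r,s}^{t,(φ,ψ)}(i)`. Positions are counted from `0`. -/
def coeffFactor {k l : ℕ} (r : Fin k → ℕ) (s : Fin l → ℕ) (t : Fin (k + l) → ℕ)
    (φ : Fin k → Fin (k + l)) (ψ : Fin l → Fin (k + l)) (i : Fin (k + l)) : ℕ :=
  if i.val = 0 ∨ ∃ i' : Fin (k + l), i'.val + 1 = i.val ∧
      ((i' ∈ Set.range φ ∧ i ∈ Set.range φ) ∨ (i' ∈ Set.range ψ ∧ i ∈ Set.range ψ)) then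
    intChoose (t i - 1) (((shuffleVec φ ψ r s i : ℕ) : ℤ) - 1)
  else
    intChoose (t i - 1) (∑ j ∈ Finset.Iic i, (t j : ℤ) -
      ∑ j ∈ Finset.Iic i, ((shuffleVec φ ψ r s j : ℕ) : ℤ))

/-- The coefficient `c_{r,s}^{t,(φ,ψ)} = ∏ i, c_{r,s}^{t,(φ,ψ)}(i)`. -/
def coeff {k l : ℕ} (r : Fin k → ℕ) (s : Fin l → ℕ) (t : Fin (k + l) → ℕ)
    (φ : Fin k → Fin (k + l)) (ψ : Fin l → Fin (k + l)) : ℕ :=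
  ∏ i, coeffFactor r s t φ ψ i

/-- The finite set of vectors of `d` positive integers with sum `n`. -/
def posVectors (d n : ℕ) : Finset (Fin d → ℕ) :=
  {t ∈ Finset.finAntidiagonal d n | ∀ i, 1 ≤ t i}

theorem mem_posVectors {d n : ℕ} {t : Fin d → ℕ} :
    t ∈ posVectors d n ↔ ∑ i, t i = n ∧ ∀ i, 1 ≤ t i := by
  simp [posVectors]

end MPV

end

/-! With `β = 1 / b`, the value `λ(s; b)` is formally the value at `x = 1` of an iterated integral
of the forms `dx / x` and `β dx / (1 - β x)`. The identity is the shuffle product of two such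
integrals, and the coefficients count the ways to interleave the forms `dx / x`.

Inside the unit disc everything is algebra of formal power series. The integral is `mpSeries`, built
from the operators `op`. The Leibniz rule for `X d/dX` and Pascal's rule give `op_mul_op`: the
product of two integrals is a binomial sum over which non-trivial form comes first. Once a letter of
one word is chosen, the exponent heading the other word may be partly used up. The induction
therefore concerns series with lowered first exponents (`mpSeriesLower_mul`). Right after a letter,
the whole excess of the `t`'s over the `h`'s is charged to the other word. Hence a change of word
involves the partial sums of `t - h`, while a repeated word involves only `h_i`
(`shuffleCoeff_eq_prod`).

To reach `x = 1`, a crude bound of order `n ^ (-1/2)` on the coefficients and Dirichlet's test give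
convergence for admissible data (`lambdaConverges_of_isAdmissible`). A nonzero coefficient forces
admissibility, and Abel's limit theorem carries the power series identity to the boundary. -/

namespace MultiplePolylog

/-! ### Iterated integration on formal power series. -/

open Finset PowerSeries

/-- The operator `g ↦ (∑_{m < n} β ^ (n - m) g_m / n ^ s)_n` on power series, which is integration
against `β dx / (1 - β x)` followed by `s - 1` integrations against `dx / x`. -/
noncomputable def op (s : ℕ) (β : ℂ) : PowerSeries ℂ →ₗ[ℂ] PowerSeries ℂ where
  toFun g := PowerSeries.mk fun n => ((n : ℂ) ^ s)⁻¹ * ∑ m ∈ range n, β ^ (n - m) * coeff m g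
  map_add' f g := by
    ext n
    simp [mul_add, sum_add_distrib]
  map_smul' c f := by
    ext n
    simp only [map_smul, coeff_mk, smul_eq_mul, RingHom.id_apply, mul_sum]
    exact sum_congr rfl fun _ _ => by ring

theorem coeff_op (s : ℕ) (β : ℂ) (g : PowerSeries ℂ) (n : ℕ) :
    coeff n (op s β g) = ((n : ℂ) ^ s)⁻¹ * ∑ m ∈ range n, β ^ (n - m) * coeff m g := by
  simp [op]

theorem constantCoeff_op (s : ℕ) (β : ℂ) (g : PowerSeries ℂ) :
    constantCoeff (op s β g) = 0 := by
  rw [← coeff_zero_eq_constantCoeff_apply, coeff_op]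
  simp

/-- The Euler derivation `X d/dX`. -/
noncomputable def euler : PowerSeries ℂ →ₗ[ℂ] PowerSeries ℂ :=
  LinearMap.mulLeft ℂ (X : PowerSeries ℂ) ∘ₗ (PowerSeries.derivative ℂ).toLinearMap

theorem coeff_euler (f : PowerSeries ℂ) (n : ℕ) : coeff n (euler f) = n * coeff n f := by
  cases n with
  | zero => simp [euler]
  | succ n => simp [euler, coeff_succ_X_mul, coeff_derivative, mul_comm]

theorem euler_mul (f g : PowerSeries ℂ) : euler (f * g) = euler f * g + f * euler g := by
  simp only [euler, LinearMap.comp_apply, LinearMap.mulLeft_apply, Derivation.coeFn_coe,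
    Derivation.leibniz, smul_eq_mul]
  ring

theorem euler_op_succ (s : ℕ) (β : ℂ) (g : PowerSeries ℂ) :
    euler (op (s + 1) β g) = op s β g := by
  ext n
  rw [coeff_euler, coeff_op, coeff_op]
  rcases eq_or_ne n 0 with rfl | hn
  · simp
  · have : (n : ℂ) ≠ 0 := by exact_mod_cast hn
    rw [pow_succ, mul_inv, ← mul_assoc, mul_comm _ ((n : ℂ)⁻¹), ← mul_assoc,
      mul_inv_cancel₀ this, one_mul]

theorem eq_of_euler_eq {f g : PowerSeries ℂ} (h0 : coeff 0 f = coeff 0 g)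
    (h : euler f = euler g) : f = g := by
  ext n
  rcases eq_or_ne n 0 with rfl | hn
  · exact h0
  · have := congrArg (coeff n) h
    rw [coeff_euler, coeff_euler] at this
    exact mul_left_cancel₀ (by exact_mod_cast hn) this

theorem op_zero_eq_mul (β : ℂ) (g : PowerSeries ℂ) :
    op 0 β g = g * PowerSeries.mk fun n => if n = 0 then 0 else β ^ n := by
  ext n
  rw [coeff_op, coeff_mul, Nat.sum_antidiagonal_eq_sum_range_succ_mk, sum_range_succ]
  simp only [pow_zero, inv_one, one_mul, coeff_mk, Nat.sub_self, if_true, mul_zero, add_zero]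
  refine sum_congr rfl fun m hm => ?_
  rw [if_neg (by have := mem_range.mp hm; omega), mul_comm]

theorem op_zero_mul (β : ℂ) (g f : PowerSeries ℂ) : op 0 β g * f = op 0 β (g * f) := by
  rw [op_zero_eq_mul, op_zero_eq_mul, mul_right_comm]

theorem sum_choose_pascal {V : Type*} [AddCommMonoid V] (r s : ℕ) (x : ℕ → V) :
    ∑ j ∈ range (s + 1), (r + j).choose j • x j =
      ∑ j ∈ range (s + 1), (r + j - 1).choose j • x j +
        ∑ j ∈ range s, (r + j).choose j • x (j + 1) := by
  rw [sum_range_succ', sum_range_succ' (fun j => (r + j - 1).choose j • x j), add_right_comm,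
    ← sum_add_distrib]
  congr 1
  · refine sum_congr rfl fun j _ => ?_
    rw [← add_smul, ← add_assoc, Nat.choose_succ_succ, add_comm]
    simp
  · simp

/-- Decomposition of a product of two iterated integrals according to which of the two leading
non-trivial forms comes first. -/
theorem op_mul_op (α β : ℂ) (f g : PowerSeries ℂ) : ∀ r s : ℕ, 0 < r + s →
    op r α f * op s β g =
      ∑ j ∈ range s, (r + j - 1).choose j • op (r + j) α (f * op (s - j) β g) +
      ∑ j ∈ range r, (s + j - 1).choose j • op (s + j) β (op (r - j) α f * g)
  | 0, 0, h => absurd h (lt_irrefl _)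
  | 0, s + 1, _ => by
    rw [op_zero_mul, sum_range_succ']
    simp
  | r + 1, 0, _ => by
    rw [mul_comm, op_zero_mul, sum_range_succ']
    simp [mul_comm]
  | r + 1, s + 1, _ => by
    -- Both sides vanish at the origin, so it suffices to compare Euler derivatives. The Leibniz
    -- rule lowers `r + 1` or `s + 1` by one, and Pascal's rule recombines the two resulting
    -- expansions.
    refine eq_of_euler_eq ?_ ?_
    · simp [constantCoeff_op]
    · rw [euler_mul, euler_op_succ, euler_op_succ, op_mul_op α β f g r (s + 1) (by omega),
        op_mul_op α β f g (r + 1) s (by omega)]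
      simp only [map_add, map_sum, map_nsmul]
      have er : ∀ j, r + 1 + j = r + j + 1 := fun j => by omega
      have es : ∀ j, s + 1 + j = s + j + 1 := fun j => by omega
      simp only [er, es, euler_op_succ, add_tsub_cancel_right]
      rw [sum_choose_pascal r s, sum_choose_pascal s r]
      simp only [Nat.add_sub_add_right, ← add_assoc]
      abel

/-- The generating series of the inner sums of a multiple polylogarithm. -/
noncomputable def mpSeries : {n : ℕ} → (Fin n → ℕ) → (Fin n → ℂ) → PowerSeries ℂ
  | 0, _, _ => 1
  | _ + 1, s, β => op (s 0) (β 0) (mpSeries (Fin.tail s) (Fin.tail β))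

/-- The series `mpSeries` with the first exponent lowered by `d`, and `0` if this is not
possible. -/
noncomputable def mpSeriesLower (d : ℕ) : {n : ℕ} → (Fin n → ℕ) → (Fin n → ℂ) → PowerSeries ℂ
  | 0, _, _ => if d = 0 then 1 else 0
  | _ + 1, s, β => if d < s 0 then op (s 0 - d) (β 0) (mpSeries (Fin.tail s) (Fin.tail β)) else 0

theorem mpSeriesLower_zero {n : ℕ} (s : Fin n → ℕ) (hs : ∀ i, 1 ≤ s i) (β : Fin n → ℂ) :
    mpSeriesLower 0 s β = mpSeries s β := by
  cases n with
  | zero => simp [mpSeriesLower, mpSeries]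
  | succ n => simp [mpSeriesLower, mpSeries, Nat.lt_of_succ_le (hs 0)]

end MultiplePolylog

/-! ### Combinatorics of shuffles and of their recursive coefficients. -/

namespace MultiplePolylog

open Finset
open MPV (posVectors shufflePairs shuffleVec mem_posVectors intChoose coeffFactor)

theorem sum_posVectors_succ {V : Type*} [AddCommMonoid V] (n M : ℕ) (f : (Fin (n + 1) → ℕ) → V) :
    ∑ t ∈ posVectors (n + 1) M, f t =
      ∑ m ∈ Icc 1 M, ∑ t ∈ posVectors n (M - m), f (Fin.cons m t) := by
  rw [sum_sigma']
  refine sum_bij' (fun t _ => ⟨t 0, Fin.tail t⟩) (fun x _ => Fin.cons x.1 x.2) ?_ ?_ ?_ ?_ ?_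
  · intro t ht
    obtain ⟨h1, h2⟩ := mem_posVectors.mp ht
    rw [Fin.sum_univ_succ] at h1
    have := h2 0
    simp only [mem_sigma, mem_Icc, mem_posVectors]
    exact ⟨⟨this, by omega⟩, by simp only [Fin.tail]; omega, fun i => h2 _⟩
  · rintro ⟨m, t⟩ hx
    simp only [mem_sigma, mem_Icc, mem_posVectors] at hx
    obtain ⟨⟨h1, h2⟩, h3, h4⟩ := hx
    refine mem_posVectors.mpr ⟨?_, fun i => ?_⟩
    · rw [Fin.sum_univ_succ]
      simp only [Fin.cons_zero, Fin.cons_succ]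
      omega
    · refine Fin.cases ?_ (fun j => ?_) i
      · simpa using h1
      · simpa using h4 j
  · intro t _
    simp
  · intro x _
    simp
  · intro t _
    simp

open Classical in
/-- The pairs of strictly increasing maps into `Fin n` whose ranges partition `Fin n`. -/
noncomputable def shuffles (k l n : ℕ) : Finset ((Fin k → Fin n) × (Fin l → Fin n)) :=
  {p | StrictMono p.1 ∧ StrictMono p.2 ∧
    Disjoint (Set.range p.1) (Set.range p.2) ∧ Set.range p.1 ∪ Set.range p.2 = Set.univ}

/-- The vector with entries `a j` at `φ j` and `b j` at `ψ j`. -/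
noncomputable def merge {α : Type*} [One α] {k l n : ℕ} (p : (Fin k → Fin n) × (Fin l → Fin n))
    (a : Fin k → α) (b : Fin l → α) : Fin n → α :=
  Function.extend p.1 a (Function.extend p.2 b 1)

section shuffles

variable {k l n : ℕ} {p : (Fin k → Fin n) × (Fin l → Fin n)}

theorem mem_shuffles : p ∈ shuffles k l n ↔ StrictMono p.1 ∧ StrictMono p.2 ∧
    (∀ i j, p.1 i ≠ p.2 j) ∧ ∀ x, (∃ i, p.1 i = x) ∨ ∃ j, p.2 j = x := by
  simp only [shuffles, mem_filter, mem_univ, true_and, Set.disjoint_left, Set.mem_range,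
    Set.eq_univ_iff_forall, Set.mem_union, forall_exists_index, forall_apply_eq_imp_iff, not_exists]
  simp only [ne_eq, eq_comm]

theorem swap_mem_shuffles : p.swap ∈ shuffles l k n ↔ p ∈ shuffles k l n := by
  simp only [mem_shuffles, Prod.fst_swap, Prod.snd_swap]
  refine ⟨fun ⟨h1, h2, h3, h4⟩ => ⟨h2, h1, fun i j => (h3 j i).symm, fun x => (h4 x).symm⟩,
    fun ⟨h1, h2, h3, h4⟩ => ⟨h2, h1, fun i j => (h3 j i).symm, fun x => (h4 x).symm⟩⟩

theorem merge_left {α : Type*} [One α] (hp : p ∈ shuffles k l n) (a : Fin k → α) (b : Fin l → α)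
    (j : Fin k) : merge p a b (p.1 j) = a j :=
  (mem_shuffles.mp hp).1.injective.extend_apply _ _ _

theorem merge_right {α : Type*} [One α] (hp : p ∈ shuffles k l n) (a : Fin k → α) (b : Fin l → α)
    (j : Fin l) : merge p a b (p.2 j) = b j := by
  obtain ⟨-, h2, h3, -⟩ := mem_shuffles.mp hp
  rw [merge, Function.extend_apply' _ _ _ (fun ⟨i, hi⟩ => h3 i j hi)]
  exact h2.injective.extend_apply _ _ _

theorem merge_eq {α : Type*} [One α] (hp : p ∈ shuffles k l n) {a : Fin k → α} {b : Fin l → α}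
    {w : Fin n → α} (ha : ∀ j, w (p.1 j) = a j) (hb : ∀ j, w (p.2 j) = b j) :
    merge p a b = w := by
  funext x
  rcases (mem_shuffles.mp hp).2.2.2 x with ⟨j, rfl⟩ | ⟨j, rfl⟩
  · rw [merge_left hp, ha]
  · rw [merge_right hp, hb]

theorem merge_swap {α : Type*} [One α] (hp : p ∈ shuffles k l n) (a : Fin k → α)
    (b : Fin l → α) : merge p.swap b a = merge p a b :=
  merge_eq (swap_mem_shuffles.mpr hp) (merge_right hp a b) (merge_left hp a b)

/-- The shuffle obtained by putting a new letter of the left word in front. -/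
def consLeft (p : (Fin k → Fin n) × (Fin l → Fin n)) :
    (Fin (k + 1) → Fin (n + 1)) × (Fin l → Fin (n + 1)) :=
  (Fin.cons 0 (fun j => (p.1 j).succ), fun j => (p.2 j).succ)

theorem consLeft_mem (hp : p ∈ shuffles k l n) : consLeft p ∈ shuffles (k + 1) l (n + 1) := by
  obtain ⟨h1, h2, h3, h4⟩ := mem_shuffles.mp hp
  refine mem_shuffles.mpr ⟨?_, ?_, ?_, ?_⟩
  · intro i j hij
    refine Fin.cases (fun h => ?_) (fun j h => ?_) j hij
    · exact absurd h (Fin.not_lt_zero _)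
    · refine Fin.cases (fun _ => ?_) (fun i h => ?_) i h
      · simp [consLeft]
      · simpa [consLeft] using h1 (Fin.succ_lt_succ_iff.mp h)
  · intro i j hij
    simpa [consLeft] using h2 hij
  · intro i j
    refine Fin.cases ?_ (fun i => ?_) i
    · simpa [consLeft] using (Fin.succ_ne_zero (p.2 j)).symm
    · simpa [consLeft] using h3 i j
  · intro x
    refine Fin.cases ?_ (fun x => ?_) x
    · exact Or.inl ⟨0, by simp [consLeft]⟩
    · rcases h4 x with ⟨i, rfl⟩ | ⟨j, rfl⟩
      · exact Or.inl ⟨i.succ, by simp [consLeft]⟩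
      · exact Or.inr ⟨j, by simp [consLeft]⟩

theorem merge_consLeft {α : Type*} [One α] (hp : p ∈ shuffles k l n) (a : Fin (k + 1) → α)
    (b : Fin l → α) : merge (consLeft p) a b = Fin.cons (a 0) (merge p (Fin.tail a) b) := by
  refine merge_eq (consLeft_mem hp) (fun j => ?_) (fun j => ?_)
  · refine Fin.cases ?_ (fun j => ?_) j
    · simp [consLeft]
    · simp [consLeft, merge_left hp, Fin.tail]
  · simp [consLeft, merge_right hp]

theorem exists_consLeft_eq {q : (Fin (k + 1) → Fin (n + 1)) × (Fin l → Fin (n + 1))}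
    (hq : q ∈ shuffles (k + 1) l (n + 1)) (h0 : 0 ∈ Set.range q.1) :
    ∃ p ∈ shuffles k l n, consLeft p = q := by
  obtain ⟨h1, h2, h3, h4⟩ := mem_shuffles.mp hq
  obtain ⟨i0, hi0⟩ := h0
  have hz : q.1 0 = 0 := by
    have := h1.monotone (Fin.zero_le i0)
    rw [hi0] at this
    exact Fin.le_zero_iff.mp this
  have hl : ∀ j : Fin k, ∃ y, Fin.succ y = q.1 j.succ := fun j =>
    Fin.exists_succ_eq.mpr fun h => by
      have := h1 (Fin.succ_pos j)
      rw [h] at this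
      exact Fin.not_lt_zero _ this
  have hr : ∀ j : Fin l, ∃ y, Fin.succ y = q.2 j := fun j =>
    Fin.exists_succ_eq.mpr fun h => h3 0 j (hz.trans h.symm)
  choose φ hφ using hl
  choose ψ hψ using hr
  refine ⟨(φ, ψ), mem_shuffles.mpr ⟨?_, ?_, ?_, ?_⟩, ?_⟩
  · intro i j hij
    rw [← Fin.succ_lt_succ_iff, hφ, hφ]
    exact h1 (Fin.succ_lt_succ_iff.mpr hij)
  · intro i j hij
    rw [← Fin.succ_lt_succ_iff, hψ, hψ]
    exact h2 hij
  · intro i j h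
    refine h3 i.succ j ?_
    rw [← hφ, ← hψ]
    exact congrArg Fin.succ h
  · intro x
    rcases h4 x.succ with ⟨i, hi⟩ | ⟨j, hj⟩
    · induction i using Fin.cases with
      | zero => exact absurd (hz.symm.trans hi).symm (Fin.succ_ne_zero x)
      | succ i => exact Or.inl ⟨i, Fin.succ_injective _ ((hφ i).trans hi)⟩
    · exact Or.inr ⟨j, Fin.succ_injective _ ((hψ j).trans hj)⟩
  · refine Prod.ext (funext fun i => ?_) (funext fun j => hψ j)
    refine Fin.cases ?_ (fun i => ?_) i
    · simp [consLeft, hz]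
    · simp [consLeft, hφ]

theorem consLeft_injective :
    Function.Injective (consLeft : (Fin k → Fin n) × (Fin l → Fin n) → _) := by
  intro p q h
  refine Prod.ext (funext fun i => ?_) (funext fun j => ?_)
  · simpa [consLeft] using congrFun (congrArg Prod.fst h) i.succ
  · simpa [consLeft] using congrFun (congrArg Prod.snd h) j

end shuffles

section sums

variable {V : Type*} [AddCommMonoid V] {k l n : ℕ}

open Classical in
theorem sum_shuffles_left (f : (Fin (k + 1) → Fin (n + 1)) × (Fin l → Fin (n + 1)) → V) :
    ∑ p ∈ shuffles (k + 1) l (n + 1) with 0 ∈ Set.range p.1, f p =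
      ∑ p ∈ shuffles k l n, f (consLeft p) := by
  symm
  refine sum_bij (fun p _ => consLeft p) (fun p hp => ?_) (fun p _ q _ h => consLeft_injective h)
    (fun q hq => ?_) (fun _ _ => rfl)
  · exact mem_filter.mpr ⟨consLeft_mem hp, 0, by simp [consLeft]⟩
  · obtain ⟨p, hp, h⟩ := exists_consLeft_eq (mem_filter.mp hq).1 (mem_filter.mp hq).2
    exact ⟨p, hp, h⟩

open Classical in
theorem sum_shuffles_swap (f : (Fin k → Fin (n + 1)) × (Fin l → Fin (n + 1)) → V) :
    ∑ p ∈ shuffles k l (n + 1) with 0 ∈ Set.range p.2, f p =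
      ∑ p ∈ shuffles l k (n + 1) with 0 ∈ Set.range p.1, f p.swap := by
  refine sum_bij' (fun p _ => p.swap) (fun p _ => p.swap) ?_ ?_ ?_ ?_ ?_ <;>
    simp +contextual [swap_mem_shuffles]

open Classical in
-- Position `0` lies in exactly one of the two images.
theorem sum_shuffles_split (f : (Fin k → Fin (n + 1)) × (Fin l → Fin (n + 1)) → V) :
    ∑ p ∈ shuffles k l (n + 1), f p =
      ∑ p ∈ shuffles k l (n + 1) with 0 ∈ Set.range p.1, f p +
        ∑ p ∈ shuffles k l (n + 1) with 0 ∈ Set.range p.2, f p := by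
  rw [← sum_filter_add_sum_filter_not (shuffles k l (n + 1)) (fun p => 0 ∈ Set.range p.1)]
  congr 1
  refine sum_congr (filter_congr fun p hp => ?_) fun _ _ => rfl
  obtain ⟨-, -, h3, h4⟩ := mem_shuffles.mp hp
  refine ⟨fun h => (h4 0).resolve_left h, ?_⟩
  rintro ⟨j, hj⟩ ⟨i, hi⟩
  exact h3 i j (hi.trans hj.symm)

end sums

/-- The coefficient of a shuffle, read from left to right; `d` and `e` are the amounts by which
the first remaining exponents of the left and of the right vector have been used up. -/
def shuffleCoeff : {n : ℕ} → ℤ → ℤ → (Fin n → Bool) → (Fin n → ℕ) → (Fin n → ℕ) → ℕ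
  | 0, _, _, _, _, _ => 1
  | _ + 1, d, e, σ, h, t =>
    if σ 0 then
      intChoose (t 0 - 1) (h 0 - d - 1) *
        shuffleCoeff 0 (e + t 0 + d - h 0) (Fin.tail σ) (Fin.tail h) (Fin.tail t)
    else
      intChoose (t 0 - 1) (h 0 - e - 1) *
        shuffleCoeff (d + t 0 + e - h 0) 0 (Fin.tail σ) (Fin.tail h) (Fin.tail t)

/-- Exchanging the two words is a symmetry, so only shuffles that start with the left word need to
be analysed. -/
theorem shuffleCoeff_not : ∀ {n : ℕ} (d e : ℤ) (σ : Fin n → Bool) (h t : Fin n → ℕ),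
    shuffleCoeff e d (fun i => !σ i) h t = shuffleCoeff d e σ h t
  | 0, _, _, _, _, _ => rfl
  | n + 1, d, e, σ, h, t => by
    have ih := fun d e => shuffleCoeff_not d e (Fin.tail σ) (Fin.tail h) (Fin.tail t)
    rw [shuffleCoeff, shuffleCoeff]
    have : Fin.tail (fun i => !σ i) = fun i => !(Fin.tail σ i) := rfl
    rw [this, ih, ih]
    cases σ 0 <;> simp

open Classical in
/-- The indicator of the positions of the left word. -/
noncomputable def isLeft {k l n : ℕ} (p : (Fin k → Fin n) × (Fin l → Fin n)) (i : Fin n) : Bool :=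
  decide (i ∈ Set.range p.1)

theorem isLeft_swap {k l n : ℕ} {p : (Fin k → Fin n) × (Fin l → Fin n)}
    (hp : p ∈ shuffles k l n) : isLeft p.swap = fun i => !isLeft p i := by
  obtain ⟨-, -, h3, h4⟩ := mem_shuffles.mp hp
  funext i
  have : i ∈ Set.range p.2 ↔ ¬ i ∈ Set.range p.1 :=
    ⟨fun ⟨j, hj⟩ ⟨i', hi⟩ => h3 i' j (hi.trans hj.symm), fun h => (h4 i).resolve_left h⟩
  simp only [isLeft, Prod.fst_swap, this, decide_not]

theorem isLeft_consLeft {k l n : ℕ} (p : (Fin k → Fin n) × (Fin l → Fin n)) :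
    isLeft (consLeft p) = Fin.cons true (isLeft p) := by
  funext i
  refine Fin.cases ?_ (fun i => ?_) i
  · simp [isLeft, consLeft]
  · simp [isLeft, consLeft]

/-- The term of the shuffle product indexed by `t` and by the shuffle `p`. -/
noncomputable def shuffleTerm {k l n : ℕ} (d e : ℤ) (r : Fin k → ℕ) (s : Fin l → ℕ)
    (α : Fin k → ℂ) (β : Fin l → ℂ) (t : Fin n → ℕ) (p : (Fin k → Fin n) × (Fin l → Fin n)) :
    PowerSeries ℂ :=
  shuffleCoeff d e (isLeft p) (merge p r s) t • mpSeries t (merge p α β)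

theorem shuffleTerm_swap {k l n : ℕ} (d e : ℤ) (r : Fin k → ℕ) (s : Fin l → ℕ) (α : Fin k → ℂ)
    (β : Fin l → ℂ) (t : Fin n → ℕ) {p : (Fin k → Fin n) × (Fin l → Fin n)}
    (hp : p ∈ shuffles k l n) :
    shuffleTerm e d s r β α t p.swap = shuffleTerm d e r s α β t p := by
  rw [shuffleTerm, shuffleTerm, isLeft_swap hp, shuffleCoeff_not, merge_swap hp, merge_swap hp]

theorem shuffleTerm_consLeft {k l n : ℕ} (d e : ℤ) (r : Fin (k + 1) → ℕ) (s : Fin l → ℕ)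
    (α : Fin (k + 1) → ℂ) (β : Fin l → ℂ) (m : ℕ) (t : Fin n → ℕ)
    {p : (Fin k → Fin n) × (Fin l → Fin n)} (hp : p ∈ shuffles k l n) :
    shuffleTerm d e r s α β (Fin.cons m t : Fin (n + 1) → ℕ) (consLeft p) =
      intChoose (m - 1) (r 0 - d - 1) • op m (α 0)
        (shuffleTerm 0 (e + m + d - r 0) (Fin.tail r) s (Fin.tail α) β t p) := by
  simp only [shuffleTerm, isLeft_consLeft, merge_consLeft hp, shuffleCoeff, mpSeries, Fin.cons_zero,
    Fin.tail_cons, if_true, map_nsmul, mul_smul]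

/-- The bound for the number of times that the first exponent can be lowered, after being
lowered `d` times. -/
def lowerBound (d : ℕ) : {n : ℕ} → (Fin n → ℕ) → ℕ
  | 0, _ => if d = 0 then 1 else 0
  | _ + 1, s => s 0 - d

theorem mpSeriesLower_eq_zero {n : ℕ} {d j : ℕ} {s : Fin n → ℕ} (h : lowerBound d s ≤ j)
    (β : Fin n → ℂ) : mpSeriesLower (d + j) s β = 0 := by
  cases n with
  | zero =>
    have : d + j ≠ 0 := by
      simp only [lowerBound] at h
      split_ifs at h <;> omega
    rw [mpSeriesLower, if_neg this]
  | succ n =>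
    simp only [lowerBound] at h
    rw [mpSeriesLower, if_neg (by omega)]

/-- Keeps the exponent `r 0 - d + j` of `sum_intChoose_op` within `Icc 1 M`. -/
theorem lowerBound_le {n : ℕ} {d : ℕ} {s : Fin n → ℕ} (h : 0 < lowerBound d s) :
    lowerBound d s + d ≤ ∑ i, s i + 1 := by
  cases n with
  | zero => simp only [lowerBound] at h ⊢; split_ifs at h ⊢ <;> simp_all
  | succ n =>
    simp only [lowerBound, Fin.sum_univ_succ] at h ⊢
    omega

/-- Sum over the first exponent of a shuffle that starts with the left word. -/
theorem sum_intChoose_op {k l : ℕ} {r : Fin (k + 1) → ℕ} {s : Fin l → ℕ} {d e M : ℕ}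
    (hd : d < r 0) (hM : M + d + e = ∑ i, r i + ∑ i, s i) (α : Fin (k + 1) → ℂ) (β : Fin l → ℂ) :
    ∑ m ∈ Icc 1 M, intChoose (m - 1) (r 0 - d - 1) • op m (α 0)
        (mpSeries (Fin.tail r) (Fin.tail α) * mpSeriesLower (e + m + d - r 0) s β) =
      ∑ j ∈ range (lowerBound e s), (r 0 - d + j - 1).choose j • op (r 0 - d + j) (α 0)
        (mpSeries (Fin.tail r) (Fin.tail α) * mpSeriesLower (e + j) s β) := by
  symm
  -- Substitute `m = r 0 - d + j`. For smaller `m` the binomial coefficient vanishes; for `j` beyond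
  -- `lowerBound e s` the lowered series vanishes.
  refine sum_of_injOn (fun j => r 0 - d + j) (fun a _ b _ h => by simpa using h) ?_ ?_ ?_
  · intro j hj
    have hj := mem_range.mp (mem_coe.mp hj)
    have := lowerBound_le (d := e) (s := s) (by omega)
    rw [Fin.sum_univ_succ] at hM
    simp only [coe_Icc, Set.mem_Icc]
    omega
  · intro m hm hm'
    rcases lt_or_ge m (r 0 - d) with h | h
    · have : intChoose (m - 1) (r 0 - d - 1) = 0 := by
        rw [intChoose, if_pos (by omega), Nat.choose_eq_zero_of_lt]
        have := (mem_Icc.mp hm).1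
        omega
      rw [this, zero_smul]
    · obtain ⟨j, rfl⟩ := Nat.exists_eq_add_of_le h
      have hj : lowerBound e s ≤ j := by
        by_contra hj
        exact hm' ⟨j, by simpa using hj, rfl⟩
      rw [show e + (r 0 - d + j) + d - r 0 = e + j by omega, mpSeriesLower_eq_zero hj]
      simp
  · intro j _
    rw [show e + (r 0 - d + j) + d - r 0 = e + j by omega, intChoose, if_pos (by omega),
      ← Nat.choose_symm_of_eq_add (a := j) (b := ((r 0 : ℤ) - d - 1).toNat) (by omega)]

theorem sum_intChoose_op_eq_zero {k l : ℕ} {r : Fin (k + 1) → ℕ} {s : Fin l → ℕ} {d : ℕ}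
    (hd : r 0 ≤ d) (e M : ℕ) (α : Fin (k + 1) → ℂ) (β : Fin l → ℂ) :
    ∑ m ∈ Icc 1 M, intChoose (m - 1) (r 0 - d - 1) • op m (α 0)
        (mpSeries (Fin.tail r) (Fin.tail α) * mpSeriesLower (e + m + d - r 0) s β) = 0 :=
  sum_eq_zero fun m _ => by rw [intChoose, if_neg (by omega), zero_smul]

end MultiplePolylog

/-! ### The shuffle product of generating series. -/

namespace MultiplePolylog

open Finset
open MPV (posVectors shufflePairs shuffleVec mem_posVectors intChoose coeffFactor)

open Classical in
-- Peels off the first exponent `m` and the first left letter. What `m` exceeds `r 0 - d` by is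
-- charged to `s`, and `ih` resums the remaining shuffles.
theorem sum_shuffleTerm_left {k l n : ℕ} {r : Fin (k + 1) → ℕ} {s : Fin l → ℕ} {d e M : ℕ}
    (hM : M + d + e = ∑ i, r i + ∑ i, s i) (α : Fin (k + 1) → ℂ) (β : Fin l → ℂ)
    (ih : ∀ e' M', M' + e' = ∑ i, Fin.tail r i + ∑ i, s i →
      mpSeries (Fin.tail r) (Fin.tail α) * mpSeriesLower e' s β =
        ∑ t ∈ posVectors n M', ∑ p ∈ shuffles k l n,
          shuffleTerm 0 e' (Fin.tail r) s (Fin.tail α) β t p) :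
    ∑ t ∈ posVectors (n + 1) M, ∑ p ∈ shuffles (k + 1) l (n + 1) with 0 ∈ Set.range p.1,
        shuffleTerm d e r s α β t p =
      ∑ m ∈ Icc 1 M, intChoose (m - 1) (r 0 - d - 1) • op m (α 0)
        (mpSeries (Fin.tail r) (Fin.tail α) * mpSeriesLower (e + m + d - r 0) s β) := by
  rw [sum_posVectors_succ]
  refine sum_congr rfl fun m hm => ?_
  have hm := mem_Icc.mp hm
  have h1 : ∀ t ∈ posVectors n (M - m),
      ∑ p ∈ shuffles (k + 1) l (n + 1) with 0 ∈ Set.range p.1,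
        shuffleTerm d e r s α β (Fin.cons m t : Fin (n + 1) → ℕ) p =
      ∑ p ∈ shuffles k l n, intChoose (m - 1) (r 0 - d - 1) • op m (α 0)
        (shuffleTerm 0 (e + m + d - r 0) (Fin.tail r) s (Fin.tail α) β t p) := fun t _ => by
    rw [sum_shuffles_left]
    exact sum_congr rfl fun p hp => shuffleTerm_consLeft (d : ℤ) e r s α β m t hp
  rw [sum_congr rfl h1]
  simp only [← smul_sum, ← map_sum]
  -- A nonzero coefficient forces `r 0 ≤ m + d`, so the truncated subtraction agrees with the one in
  -- `ℤ`.
  by_cases hz : intChoose (m - 1) ((r 0 : ℤ) - d - 1) = 0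
  · rw [hz, zero_smul, zero_smul]
  · have hle : r 0 ≤ m + d := by
      by_contra hlt
      refine hz ?_
      rw [intChoose, if_pos (by omega), Nat.choose_eq_zero_of_lt]
      omega
    rw [Fin.sum_univ_succ] at hM
    rw [ih (e + m + d - r 0) (M - m) (by simp only [Fin.tail]; omega),
      show ((e + m + d - r 0 : ℕ) : ℤ) = e + m + d - r 0 by omega]

open Classical in
theorem sum_shuffleTerm_swap {k l n : ℕ} (d e : ℤ) (r : Fin k → ℕ) (s : Fin l → ℕ)
    (α : Fin k → ℂ) (β : Fin l → ℂ) (t : Fin (n + 1) → ℕ) :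
    ∑ p ∈ shuffles k l (n + 1) with 0 ∈ Set.range p.2, shuffleTerm d e r s α β t p =
      ∑ p ∈ shuffles l k (n + 1) with 0 ∈ Set.range p.1, shuffleTerm e d s r β α t p := by
  rw [sum_shuffles_swap]
  refine sum_congr rfl fun p hp => ?_
  rw [shuffleTerm_swap e d s r β α t (mem_filter.mp hp).1]

/-- The shuffle product of two series, the first exponents of which are lowered by `d` and `e`. -/
theorem mpSeriesLower_mul : ∀ {n k l : ℕ} (r : Fin k → ℕ) (s : Fin l → ℕ) (α : Fin k → ℂ)
    (β : Fin l → ℂ) (d e M : ℕ), n = k + l → (∀ i, 1 ≤ r i) → (∀ i, 1 ≤ s i) →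
    M + d + e = ∑ i, r i + ∑ i, s i →
    mpSeriesLower d r α * mpSeriesLower e s β =
      ∑ t ∈ posVectors n M, ∑ p ∈ shuffles k l n, shuffleTerm d e r s α β t p := by
  intro n
  -- The length is a variable with `n = k + l`, so that shortening either word needs no casts.
  induction n with
  | zero =>
    intro k l r s α β d e M hn hr hs hM
    obtain rfl : k = 0 := by omega
    obtain rfl : l = 0 := by omega
    simp only [univ_eq_empty, sum_empty] at hM
    obtain rfl : M = 0 := by omega
    obtain rfl : d = 0 := by omega
    obtain rfl : e = 0 := by omega
    have h1 : posVectors 0 0 = {default} := by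
      ext t
      simp [mem_posVectors, Subsingleton.elim t default]
    have h2 : shuffles 0 0 0 = {default} := by
      ext p
      simp [mem_shuffles, Subsingleton.elim p default, StrictMono]
    simp [h1, h2, shuffleTerm, shuffleCoeff, mpSeries, mpSeriesLower]
  | succ n ih =>
    intro k l r s α β d e M hn hr hs hM
    simp only [sum_shuffles_split, sum_add_distrib, sum_shuffleTerm_swap]
    cases k with
    | zero =>
      cases l with
      | zero => omega
      | succ l =>
        rw [sum_shuffleTerm_left (by omega) β α fun d' M' h => by
          have := ih (Fin.tail s) r (Fin.tail β) α 0 d' M' (by omega) (fun i => hs _) hr (by omega)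
          rwa [mpSeriesLower_zero (Fin.tail s) (fun i => hs _)] at this]
        have h0 : ∀ t, ∑ p ∈ shuffles 0 (l + 1) (n + 1) with 0 ∈ Set.range p.1,
            shuffleTerm d e r s α β t p = 0 := fun t => by simp
        rw [sum_eq_zero fun t _ => h0 t, zero_add]
        rcases le_or_gt (s 0) e with he | he
        · rw [sum_intChoose_op_eq_zero he]
          simp [mpSeriesLower, he.not_gt]
        · rw [sum_intChoose_op he (by omega)]
          -- The empty word can only be lowered by `0`: the sum has the single term `j = 0` if `d =
          -- 0` and is empty otherwise.
          rcases eq_or_ne d 0 with rfl | hd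
          · simp [mpSeriesLower, he, lowerBound]
          · simp [mpSeriesLower, lowerBound, hd]
    | succ k =>
      rw [sum_shuffleTerm_left hM α β fun e' M' h => by
        have := ih (Fin.tail r) s (Fin.tail α) β 0 e' M' (by omega) (fun i => hr _) hs (by omega)
        rwa [mpSeriesLower_zero (Fin.tail r) (fun i => hr _)] at this]
      cases l with
      | zero =>
        have h0 : ∀ t, ∑ p ∈ shuffles 0 (k + 1) (n + 1) with 0 ∈ Set.range p.1,
            shuffleTerm e d s r β α t p = 0 := fun t => by simp
        rw [sum_eq_zero fun t _ => h0 t, add_zero]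
        rcases le_or_gt (r 0) d with hd | hd
        · rw [sum_intChoose_op_eq_zero hd]
          simp [mpSeriesLower, hd.not_gt]
        · rw [sum_intChoose_op hd hM]
          rcases eq_or_ne e 0 with rfl | he
          · simp [mpSeriesLower, hd, lowerBound]
          · simp [mpSeriesLower, lowerBound, he]
      | succ l =>
        rw [sum_shuffleTerm_left (by omega) β α fun d' M' h => by
          have := ih (Fin.tail s) r (Fin.tail β) α 0 d' M' (by omega) (fun i => hs _) hr (by omega)
          rwa [mpSeriesLower_zero (Fin.tail s) (fun i => hs _)] at this]
        rcases le_or_gt (r 0) d with hd | hd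
        · rw [sum_intChoose_op_eq_zero hd, zero_add]
          -- An exhausted first exponent stays exhausted under further lowering, so every term of
          -- the other sum vanishes too.
          have hz : ∀ x, mpSeriesLower (d + x) r α = 0 := fun x =>
            mpSeriesLower_eq_zero (by simp [lowerBound]; omega) α
          rw [show mpSeriesLower d r α = 0 from hz 0, zero_mul]
          rcases le_or_gt (s 0) e with he | he
          · rw [sum_intChoose_op_eq_zero he]
          · rw [sum_intChoose_op he (by omega)]
            simp [hz]
        · rcases le_or_gt (s 0) e with he | he
          · rw [sum_intChoose_op_eq_zero he, sum_intChoose_op hd hM]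
            have hz : ∀ x, mpSeriesLower (e + x) s β = 0 := fun x =>
              mpSeriesLower_eq_zero (by simp [lowerBound]; omega) β
            rw [show mpSeriesLower e s β = 0 from hz 0]
            simp [hz]
          · rw [sum_intChoose_op hd hM, sum_intChoose_op he (by omega)]
            have h1 : mpSeriesLower d r α =
                op (r 0 - d) (α 0) (mpSeries (Fin.tail r) (Fin.tail α)) := by
              rw [mpSeriesLower, if_pos hd]
            have h2 : mpSeriesLower e s β =
                op (s 0 - e) (β 0) (mpSeries (Fin.tail s) (Fin.tail β)) := by
              rw [mpSeriesLower, if_pos he]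
            rw [h1, h2, op_mul_op _ _ _ _ _ _ (by omega)]
            have h3 : ∀ j ∈ range (s 0 - e), mpSeriesLower (e + j) s β =
                op (s 0 - e - j) (β 0) (mpSeries (Fin.tail s) (Fin.tail β)) := fun j hj => by
              have := mem_range.mp hj
              rw [mpSeriesLower, if_pos (by omega), Nat.sub_sub]
            have h4 : ∀ j ∈ range (r 0 - d), mpSeriesLower (d + j) r α =
                op (r 0 - d - j) (α 0) (mpSeries (Fin.tail r) (Fin.tail α)) := fun j hj => by
              have := mem_range.mp hj
              rw [mpSeriesLower, if_pos (by omega), Nat.sub_sub]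
            exact congrArg₂ (· + ·) (sum_congr rfl fun j hj => by rw [h3 j hj])
              (sum_congr rfl fun j hj => by rw [h4 j hj, mul_comm (mpSeries _ _)])

/-! ### Closed form of the shuffle coefficients. -/

theorem intChoose_symm (n : ℕ) (m : ℤ) : intChoose n (n - m) = intChoose n m := by
  rw [intChoose, intChoose]
  split_ifs with h1 h2 h2
  · rw [← Nat.choose_symm (by omega : m.toNat ≤ n)]
    congr 1
    omega
  · exact Nat.choose_eq_zero_of_lt (by omega)
  · exact (Nat.choose_eq_zero_of_lt (by omega)).symm
  · rfl

/-- The explicit form of the coefficient of a shuffle after a letter of the left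
(`b = true`) or right (`b = false`) word. -/
theorem shuffleCoeff_eq_prod : ∀ {n : ℕ} (b : Bool) (d : ℤ) (σ : Fin n → Bool) (h t : Fin n → ℕ),
    (∀ i, 1 ≤ t i) →
    shuffleCoeff (if b then 0 else d) (if b then d else 0) σ h t =
      ∏ i, if (Fin.cons b σ : Fin (n + 1) → Bool) i.castSucc = σ i then
          intChoose (t i - 1) (h i - 1)
        else intChoose (t i - 1) (d + ∑ j ∈ Iic i, ((t j : ℤ) - h j))
  | 0, _, _, _, _, _, _ => by simp [shuffleCoeff]
  | n + 1, b, d, σ, h, t, ht => by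
    have hI : ∀ i : Fin n, ∑ j ∈ Iic i.succ, ((t j : ℤ) - h j) =
        (t 0 - h 0) + ∑ j ∈ Iic i, ((Fin.tail t j : ℤ) - Fin.tail h j) := fun i => by
      rw [← filter_ge_eq_Iic, ← filter_ge_eq_Iic, sum_filter, sum_filter, Fin.sum_univ_succ]
      simp [Fin.tail]
    have hcons : ∀ i : Fin n, (Fin.cons b σ : Fin (n + 2) → Bool) i.succ.castSucc =
        (Fin.cons (σ 0) (Fin.tail σ) : Fin (n + 1) → Bool) i.castSucc := fun i => by
      rw [Fin.cons_self_tail, ← Fin.succ_castSucc, Fin.cons_succ]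
    have ih := fun d => shuffleCoeff_eq_prod (σ 0) d (Fin.tail σ) (Fin.tail h) (Fin.tail t)
      fun i => ht _
    rw [Fin.prod_univ_succ]
    simp only [hI, hcons]
    have h0 : ∑ j ∈ Iic (0 : Fin (n + 1)), ((t j : ℤ) - h j) = t 0 - h 0 := by
      rw [show Iic (0 : Fin (n + 1)) = {0} from rfl, sum_singleton]
    -- Binomial symmetry turns the lower index of the recursion into the running excess of `t` over
    -- `h`.
    have hs : intChoose (t 0 - 1) (d + (t 0 - h 0)) = intChoose (t 0 - 1) (h 0 - d - 1) := by
      rw [← intChoose_symm]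
      congr 1
      have := ht 0
      omega
    simp only [← add_assoc]
    refine Eq.trans ?_ (congrArg (fun x => (if (Fin.cons b σ : Fin (n + 2) → Bool)
      (Fin.castSucc 0) = σ 0 then intChoose (t 0 - 1) (h 0 - 1)
        else intChoose (t 0 - 1) (d + ∑ j ∈ Iic 0, ((t j : ℤ) - h j))) * x)
      (ih (d + (t 0 - h 0))))
    simp only [h0, hs, Fin.castSucc_zero, Fin.cons_zero, shuffleCoeff]
    have e1 : (t 0 : ℤ) + d - h 0 = d + (t 0 - h 0) := by ring
    have e2 : d + (t 0 : ℤ) - h 0 = d + (t 0 - h 0) := by ring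
    cases b <;> cases σ 0 <;> simp [e1, e2]

theorem coeff_eq_shuffleCoeff {k l : ℕ} (r : Fin k → ℕ) (s : Fin l → ℕ) {t : Fin (k + l) → ℕ}
    (ht : ∀ i, 1 ≤ t i) {p : (Fin k → Fin (k + l)) × (Fin l → Fin (k + l))}
    (hp : p ∈ shufflePairs k l) :
    MPV.coeff r s t p.1 p.2 = shuffleCoeff 0 0 (isLeft p) (merge p r s) t := by
  have hp' : p ∈ shuffles k l (k + l) := hp
  obtain ⟨-, -, h3, h4⟩ := mem_shuffles.mp hp'
  have hR : ∀ i, i ∈ Set.range p.2 ↔ ¬ i ∈ Set.range p.1 := fun i =>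
    ⟨fun ⟨j, hj⟩ ⟨i', hi⟩ => h3 i' j (hi.trans hj.symm), fun h => (h4 i).resolve_left h⟩
  -- A fictitious left letter precedes the word. Its side is immaterial: at position `0` nothing is
  -- used up, and the two binomial forms agree by symmetry.
  have key := shuffleCoeff_eq_prod true 0 (isLeft p) (merge p r s) t ht
  simp only [if_true] at key
  rw [key, MPV.coeff]
  refine prod_congr rfl fun i _ => ?_
  rw [coeffFactor, show shuffleVec p.1 p.2 r s = merge p r s from rfl]
  obtain ⟨m, hm⟩ := i
  cases m with
  | zero =>
    rw [if_pos (Or.inl rfl)]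
    split_ifs with h
    · rfl
    · have h0 : Iic (⟨0, hm⟩ : Fin (k + l)) = {⟨0, hm⟩} := by
        ext x
        simp [Fin.le_def, Fin.ext_iff]
      rw [h0, sum_singleton, zero_add, ← intChoose_symm]
      congr 1
      have := ht ⟨0, hm⟩
      omega
  | succ m =>
    have h1 : (Fin.cons true (isLeft p) : Fin (k + l + 1) → Bool)
        (Fin.castSucc ⟨m + 1, hm⟩) = isLeft p ⟨m, by omega⟩ := rfl
    have h2 : ((⟨m + 1, hm⟩ : Fin (k + l)).val = 0 ∨ ∃ i' : Fin (k + l),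
        i'.val + 1 = (⟨m + 1, hm⟩ : Fin (k + l)).val ∧
        ((i' ∈ Set.range p.1 ∧ (⟨m + 1, hm⟩ : Fin (k + l)) ∈ Set.range p.1) ∨
          (i' ∈ Set.range p.2 ∧ (⟨m + 1, hm⟩ : Fin (k + l)) ∈ Set.range p.2))) ↔
        isLeft p ⟨m, by omega⟩ = isLeft p ⟨m + 1, hm⟩ := by
      rw [isLeft, isLeft, decide_eq_decide]
      constructor
      · rintro (h | ⟨i', hi, h⟩)
        · exact absurd h (Nat.succ_ne_zero m)
        · rw [show i' = ⟨m, by omega⟩ from Fin.ext (by simpa using hi)] at h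
          rw [hR, hR] at h
          tauto
      · intro h
        refine Or.inr ⟨⟨m, by omega⟩, rfl, ?_⟩
        rw [hR, hR]
        tauto
    simp only [h1, h2, zero_add, sum_sub_distrib]

/-- The shuffle product formula for the generating series. -/
theorem mpSeries_mul {k l : ℕ} (r : Fin k → ℕ) (s : Fin l → ℕ) (hr : ∀ i, 1 ≤ r i)
    (hs : ∀ i, 1 ≤ s i) (α : Fin k → ℂ) (β : Fin l → ℂ) :
    mpSeries r α * mpSeries s β =
      ∑ t ∈ posVectors (k + l) (∑ i, r i + ∑ i, s i), ∑ p ∈ shufflePairs k l,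
        MPV.coeff r s t p.1 p.2 • mpSeries t (merge p α β) := by
  rw [← mpSeriesLower_zero r hr, ← mpSeriesLower_zero s hs,
    mpSeriesLower_mul r s α β 0 0 (∑ i, r i + ∑ i, s i) rfl hr hs (by simp)]
  refine sum_congr rfl fun t ht => sum_congr rfl fun p hp => ?_
  rw [coeff_eq_shuffleCoeff r s (mem_posVectors.mp ht).2 hp]
  rfl

end MultiplePolylog

/-! ### Partial sums as sums of coefficients, and convergence. -/

namespace MultiplePolylog

open Finset PowerSeries
open MPV (liPartial lambdaPartial theta)

theorem strictAnti_cons {k m : ℕ} {f : Fin k → ℕ} :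
    StrictAnti (Fin.cons m f : Fin (k + 1) → ℕ) ↔ (∀ i, f i < m) ∧ StrictAnti f := by
  constructor
  · intro h
    refine ⟨fun i => ?_, fun i j hij => ?_⟩
    · simpa using h (Fin.succ_pos i)
    · simpa using h (Fin.succ_lt_succ_iff.mpr hij)
  · rintro ⟨h1, h2⟩ i j hij
    induction j using Fin.cases with
    | zero => exact absurd hij (Fin.not_lt_zero _)
    | succ j =>
      induction i using Fin.cases with
      | zero => simpa using h1 j
      | succ i => simpa using h2 (Fin.succ_lt_succ_iff.mp hij)

theorem liPartial_succ {k : ℕ} (s : Fin (k + 1) → ℕ) (z : Fin (k + 1) → ℂ) (N : ℕ) :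
    liPartial s z N = ∑ m ∈ Icc 1 N, z 0 ^ m / (m : ℂ) ^ s 0 *
      liPartial (Fin.tail s) (Fin.tail z) (m - 1) := by
  simp only [liPartial, mul_sum]
  rw [sum_sigma']
  refine sum_bij' (fun f _ => ⟨f 0, Fin.tail f⟩) (fun x _ => Fin.cons x.1 x.2) ?_ ?_ ?_ ?_ ?_
  · intro f hf
    simp only [mem_filter, Fintype.mem_piFinset, mem_Icc, mem_sigma] at hf ⊢
    obtain ⟨h1, h2⟩ := hf
    rw [← Fin.cons_self_tail f, strictAnti_cons] at h2
    refine ⟨h1 0, fun i => ⟨(h1 i.succ).1, ?_⟩, h2.2⟩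
    have := h2.1 i
    omega
  · rintro ⟨m, f⟩ hx
    simp only [mem_filter, Fintype.mem_piFinset, mem_Icc, mem_sigma] at hx ⊢
    obtain ⟨h1, h2, h3⟩ := hx
    refine ⟨fun i => ?_, strictAnti_cons.mpr ⟨fun i => ?_, h3⟩⟩
    · refine Fin.cases (by simpa using h1) (fun i => ?_) i
      have := h2 i
      simp only [Fin.cons_succ]
      omega
    · have := h2 i
      omega
  · intro f _
    simp
  · intro x _
    simp
  · intro f _
    rw [Fin.prod_univ_succ]
    rfl

/-- The vector `(c / b₁, b₁ / b₂, …, b_{k-1} / b_k)`. -/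
noncomputable def thetaFrom {k : ℕ} (c : Circle) (b : Fin k → Circle) (i : Fin k) : Circle :=
  (if i.val = 0 then c else b ⟨i.val - 1, by omega⟩) / b i

theorem tail_thetaFrom {k : ℕ} (c : Circle) (b : Fin (k + 1) → Circle) :
    Fin.tail (thetaFrom c b) = thetaFrom (b 0) (Fin.tail b) := by
  funext i
  obtain ⟨m, hm⟩ := i
  cases m <;> simp [Fin.tail, thetaFrom]

theorem sum_Icc_one_eq_sum_range {V : Type*} [AddCommMonoid V] (f : ℕ → V) (N : ℕ) :
    ∑ m ∈ Icc 1 N, f m = ∑ i ∈ range N, f (i + 1) := by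
  induction N with
  | zero => simp
  | succ N ih => rw [sum_Icc_succ_top (by omega), sum_range_succ, ih]

/-- The free numerator `c` is needed because the tail of the ratio vector starts with `b 0` instead
of `1`. The step is `(c / b 0) ^ n * b 0 ^ m = c ^ n * (b 0)⁻¹ ^ (n - m)`, and the strict inequality
`n₁ > n₂` becomes `m < n`. -/
theorem liPartial_thetaFrom : ∀ {k : ℕ} (c : Circle) (s : Fin k → ℕ) (b : Fin k → Circle) (N : ℕ),
    liPartial s (fun i => ((thetaFrom c b i : Circle) : ℂ)) N =
      ∑ m ∈ range (N + 1), (c : ℂ) ^ m * coeff m (mpSeries s fun i => (b i : ℂ)⁻¹)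
  | 0, c, s, b, N => by
    have h1 : liPartial s (fun i => ((thetaFrom c b i : Circle) : ℂ)) N = 1 := by
      rw [liPartial, sum_eq_single_of_mem default]
      · simp
      · exact mem_filter.mpr ⟨Fintype.mem_piFinset.mpr fun i => i.elim0, Subsingleton.strictAnti _⟩
      · exact fun f _ hf => absurd (Subsingleton.elim f default) hf
    rw [h1, sum_range_succ']
    simp [mpSeries, coeff_one]
  | k + 1, c, s, b, N => by
    rw [liPartial_succ, sum_Icc_one_eq_sum_range, sum_range_succ']
    simp only [mpSeries, coeff_zero_eq_constantCoeff_apply, constantCoeff_op, mul_zero, add_zero]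
    refine sum_congr rfl fun n _ => ?_
    have ht : Fin.tail (fun i => ((thetaFrom c b i : Circle) : ℂ)) =
        fun i => ((thetaFrom (b 0) (Fin.tail b) i : Circle) : ℂ) := by
      rw [← tail_thetaFrom]
      rfl
    have h0 : thetaFrom c b 0 = c / b 0 := by simp [thetaFrom]
    have hb : (b 0 : ℂ) ≠ 0 := Circle.coe_ne_zero _
    rw [ht, liPartial_thetaFrom (b 0) (Fin.tail s) (Fin.tail b), coeff_op, h0, Circle.coe_div,
      Nat.add_sub_cancel, mul_sum, mul_sum, mul_sum]
    refine sum_congr rfl fun m hm => ?_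
    obtain ⟨j, hj⟩ := Nat.exists_eq_add_of_le (Nat.le_of_lt (mem_range.mp hm))
    rw [hj, Nat.add_sub_cancel_left, div_pow, pow_add (b 0 : ℂ), inv_pow]
    have : Fin.tail (fun i => (b i : ℂ)⁻¹) = fun i => (Fin.tail b i : ℂ)⁻¹ := rfl
    rw [this]
    field_simp

theorem lambdaPartial_eq {k : ℕ} (s : Fin k → ℕ) (b : Fin k → Circle) (N : ℕ) :
    lambdaPartial s b N = ∑ m ∈ range (N + 1), coeff m (mpSeries s fun i => (b i : ℂ)⁻¹) := by
  have := liPartial_thetaFrom 1 s b N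
  simp only [Circle.coe_one, one_pow, one_mul] at this
  exact this

theorem sum_inv_sqrt_le (n : ℕ) : ∑ i ∈ range n, (√(i : ℝ))⁻¹ ≤ 2 * √(n : ℝ) := by
  have h : ∀ n : ℕ, ∑ i ∈ range n, (√((i + 1 : ℕ) : ℝ))⁻¹ ≤ 2 * √(n : ℝ) := fun n => by
    induction n with
    | zero => simp
    | succ n ih =>
      rw [sum_range_succ]
      have h1 : 0 < √((n + 1 : ℕ) : ℝ) := Real.sqrt_pos.mpr (by positivity)
      have h2 : √((n + 1 : ℕ) : ℝ) ^ 2 = n + 1 := by rw [Real.sq_sqrt (by positivity)]; simp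
      have h3 : √(n : ℝ) ^ 2 = n := Real.sq_sqrt (by positivity)
      -- Follows from `√(n + 1) - √n = 1 / (√(n + 1) + √n)`, a telescoping bound.
      have h4 : (√((n + 1 : ℕ) : ℝ))⁻¹ ≤ 2 * √((n + 1 : ℕ) : ℝ) - 2 * √(n : ℝ) := by
        rw [inv_le_iff_one_le_mul₀ h1]
        nlinarith [sq_nonneg (√((n + 1 : ℕ) : ℝ) - √(n : ℝ))]
      linarith
  cases n with
  | zero => simp
  | succ n =>
    rw [sum_range_succ']
    simp only [Nat.cast_zero, Real.sqrt_zero, inv_zero, add_zero]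
    refine (h n).trans ?_
    gcongr
    omega

theorem norm_coeff_op_le {s : ℕ} {β : ℂ} (hβ : ‖β‖ = 1) {g : PowerSeries ℂ} {C : ℝ}
    (hC : ∀ n, ∑ m ∈ range n, ‖coeff m g‖ ≤ C * √(n : ℝ)) (n : ℕ) :
    ‖coeff n (op s β g)‖ ≤ ((n : ℝ) ^ s)⁻¹ * (C * √(n : ℝ)) := by
  rw [coeff_op, norm_mul, norm_inv, norm_pow, Complex.norm_natCast]
  gcongr
  refine (norm_sum_le _ _).trans (le_of_eq_of_le ?_ (hC n))
  exact sum_congr rfl fun m _ => by rw [norm_mul, norm_pow, hβ, one_pow, one_mul]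

theorem norm_coeff_op_le_inv_sqrt {s : ℕ} (hs : 1 ≤ s) {β : ℂ} (hβ : ‖β‖ = 1)
    {g : PowerSeries ℂ} {C : ℝ} (hC0 : 0 ≤ C)
    (hC : ∀ n, ∑ m ∈ range n, ‖coeff m g‖ ≤ C * √(n : ℝ)) (n : ℕ) :
    ‖coeff n (op s β g)‖ ≤ C * (√(n : ℝ))⁻¹ := by
  refine (norm_coeff_op_le hβ hC n).trans ?_
  rcases Nat.eq_zero_or_pos n with rfl | hn
  · simp
  · have h1 : (1 : ℝ) ≤ n := by exact_mod_cast hn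
    have h2 : (0 : ℝ) < √(n : ℝ) := Real.sqrt_pos.mpr (by linarith)
    have h3 : ((n : ℝ) ^ s)⁻¹ ≤ (√(n : ℝ) * √(n : ℝ))⁻¹ := by
      rw [Real.mul_self_sqrt (by linarith)]
      exact inv_anti₀ (by linarith) (le_self_pow₀ h1 (by omega))
    calc ((n : ℝ) ^ s)⁻¹ * (C * √(n : ℝ)) ≤ (√(n : ℝ) * √(n : ℝ))⁻¹ * (C * √(n : ℝ)) := by
          gcongr
      _ = C * (√(n : ℝ))⁻¹ := by field_simp

/-- Square roots replace the true powers of logarithms because this bound reproduces itself: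
dividing `C √n` by `n` gives `C / √n`, whose sums are at most `2 C √n`. The case `n = 0` is excluded
from the pointwise bound since the empty series has constant term `1`. -/
theorem exists_coeff_bound : ∀ {k : ℕ} (s : Fin k → ℕ) (_ : ∀ i, 1 ≤ s i) (β : Fin k → ℂ)
    (_ : ∀ i, ‖β i‖ = 1), ∃ C : ℝ, 0 ≤ C ∧
      (∀ n, ∑ m ∈ range n, ‖coeff m (mpSeries s β)‖ ≤ C * √(n : ℝ)) ∧
      ∀ n, 1 ≤ n → ‖coeff n (mpSeries s β)‖ ≤ C * (√(n : ℝ))⁻¹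
  | 0, s, _, β, _ => by
    refine ⟨1, zero_le_one, fun n => ?_, fun n hn => ?_⟩
    · cases n with
      | zero => simp
      | succ n =>
        rw [sum_range_succ']
        simp only [mpSeries, coeff_one]
        simp
    · simp [mpSeries, coeff_one, Nat.one_le_iff_ne_zero.mp hn]
  | k + 1, s, hs, β, hβ => by
    obtain ⟨C, hC0, hC, -⟩ := exists_coeff_bound (Fin.tail s) (fun i => hs _) (Fin.tail β)
      (fun i => hβ _)
    have hb := norm_coeff_op_le_inv_sqrt (hs 0) (hβ 0) hC0 hC
    refine ⟨C * 2, by positivity, fun n => ?_, fun n _ => (hb n).trans ?_⟩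
    · refine (sum_le_sum fun m _ => hb m).trans ?_
      rw [← mul_sum, mul_assoc]
      exact mul_le_mul_of_nonneg_left (sum_inv_sqrt_le n) hC0
    · gcongr
      linarith

theorem summable_inv_mul_sqrt : Summable fun n : ℕ => ((n : ℝ) * √(n : ℝ))⁻¹ := by
  refine (Real.summable_nat_rpow_inv (p := 3 / 2)).mpr (by norm_num) |>.congr fun n => ?_
  rcases Nat.eq_zero_or_pos n with rfl | hn
  · norm_num
  · rw [Real.sqrt_eq_rpow, ← Real.rpow_one_add' (by positivity) (by norm_num)]
    norm_num

/-- Dirichlet's test for the sequence `β ^ n * c n` with `c` of bounded variation. -/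
theorem exists_tendsto_sum_pow_mul {β : ℂ} (hβ : ‖β‖ = 1) (hβ1 : β ≠ 1) {c : ℕ → ℂ}
    (hc : Tendsto c atTop (𝓝 0)) (hv : Summable fun n => ‖c (n + 1) - c n‖) :
    ∃ L, Tendsto (fun N => ∑ n ∈ range N, β ^ n * c n) atTop (𝓝 L) := by
  have h1 : Summable fun n => β ^ (n + 1) * (c (n + 1) - c n) :=
    Summable.of_norm (hv.congr fun n => by rw [norm_mul, norm_pow, hβ, one_pow, one_mul])
  have h2 : Tendsto (fun N => β ^ N * c N) atTop (𝓝 0) := by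
    rw [tendsto_zero_iff_norm_tendsto_zero] at hc ⊢
    refine hc.congr fun n => ?_
    rw [norm_mul, norm_pow, hβ, one_pow, one_mul]
  have h3 : 1 - β ≠ 0 := sub_ne_zero.mpr hβ1.symm
  -- Summation by parts, in closed form.
  have h4 : ∀ N, ∑ n ∈ range N, β ^ n * c n = (∑ n ∈ range N, β ^ (n + 1) * (c (n + 1) - c n) -
      β ^ N * c N + c 0) / (1 - β) := fun N => by
    rw [eq_div_iff h3]
    induction N with
    | zero => simp
    | succ N ih =>
      rw [sum_range_succ, add_mul, ih, sum_range_succ]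
      ring
  refine ⟨_, ((((h1.hasSum.tendsto_sum_nat).sub h2).add_const (c 0)).div_const (1 - β)).congr
    fun N => (h4 N).symm⟩

/-- For `s ≥ 2` the terms are `O(n ^ (-3/2))`. For `s = 1` they are `β ^ n * (A n / n)` with `β ≠
1`, and `A n / n` tends to `0` with increments `O(n ^ (-3/2))`, so Dirichlet's test applies. -/
theorem exists_tendsto_sum_coeff_op {s : ℕ} (hs : 1 ≤ s) {β : ℂ} (hβ : ‖β‖ = 1)
    (h1 : ¬ (s = 1 ∧ β = 1)) {g : PowerSeries ℂ} {C : ℝ} (hC0 : 0 ≤ C)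
    (hC : ∀ n, ∑ m ∈ range n, ‖coeff m g‖ ≤ C * √(n : ℝ))
    (hg : ∀ n, 1 ≤ n → ‖coeff n g‖ ≤ C * (√(n : ℝ))⁻¹) :
    ∃ L, Tendsto (fun N => ∑ n ∈ range N, coeff n (op s β g)) atTop (𝓝 L) := by
  rcases eq_or_lt_of_le hs with rfl | hs
  · have hβ0 : β ≠ 0 := norm_ne_zero_iff.mp (by rw [hβ]; exact one_ne_zero)
    set A : ℕ → ℂ := fun n => ∑ m ∈ range n, (β ^ m)⁻¹ * coeff m g with hA
    have hAn : ∀ n, ‖A n‖ ≤ C * √(n : ℝ) := fun n => by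
      refine (norm_sum_le _ _).trans (le_of_eq_of_le ?_ (hC n))
      exact sum_congr rfl fun m _ => by
        rw [norm_mul, norm_inv, norm_pow, hβ, one_pow, inv_one, one_mul]
    have hco : ∀ n, coeff n (op 1 β g) = β ^ n * ((n : ℂ)⁻¹ * A n) := fun n => by
      rw [coeff_op, pow_one, mul_left_comm, hA, mul_sum (range n) _ (β ^ n)]
      congr 1
      refine sum_congr rfl fun m hm => ?_
      rw [← mul_assoc, pow_sub₀ β hβ0 (mem_range.mp hm).le]
    simp only [hco]
    refine exists_tendsto_sum_pow_mul hβ (fun h => h1 ⟨rfl, h⟩) ?_ ?_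
    · have hlim : Tendsto (fun n : ℕ => C * (√(n : ℝ))⁻¹) atTop (𝓝 0) := by
        have := (tendsto_inv_atTop_zero.comp
          (Real.tendsto_sqrt_atTop.comp tendsto_natCast_atTop_atTop)).const_mul C
        rwa [mul_zero] at this
      refine squeeze_zero_norm (fun n => ?_) hlim
      have := norm_coeff_op_le_inv_sqrt le_rfl hβ hC0 hC n
      rwa [hco, norm_mul, norm_pow, hβ, one_pow, one_mul] at this
    · refine (summable_nat_add_iff 1).mp (Summable.of_nonneg_of_le (fun _ => norm_nonneg _)
        (fun n => ?_) ((summable_nat_add_iff 1).mpr (summable_inv_mul_sqrt.mul_left (2 * C))))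
      generalize hm : n + 1 = m
      have hm1 : 1 ≤ m := by omega
      have hm0 : (0 : ℝ) < m := by exact_mod_cast hm1
      have hmc : (m : ℂ) ≠ 0 := by exact_mod_cast hm0.ne'
      have hmc' : (m : ℂ) + 1 ≠ 0 := by exact_mod_cast Nat.succ_ne_zero m
      have hsq : 0 < √(m : ℝ) := Real.sqrt_pos.mpr hm0
      have hid : ((m + 1 : ℕ) : ℂ)⁻¹ * A (m + 1) - (m : ℂ)⁻¹ * A m =
          ((m + 1 : ℕ) : ℂ)⁻¹ * ((β ^ m)⁻¹ * coeff m g - (m : ℂ)⁻¹ * A m) := by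
        rw [hA]
        simp only [sum_range_succ]
        push_cast
        field_simp
        ring
      have hle : ((m + 1 : ℕ) : ℝ)⁻¹ ≤ (m : ℝ)⁻¹ := inv_anti₀ hm0 (by push_cast; linarith)
      rw [hid, norm_mul, norm_inv, Complex.norm_natCast]
      calc ((m + 1 : ℕ) : ℝ)⁻¹ * ‖(β ^ m)⁻¹ * coeff m g - (m : ℂ)⁻¹ * A m‖
          ≤ (m : ℝ)⁻¹ * (C * (√(m : ℝ))⁻¹ + (m : ℝ)⁻¹ * (C * √(m : ℝ))) := by
            refine mul_le_mul hle ((norm_sub_le _ _).trans (add_le_add ?_ ?_)) (norm_nonneg _)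
              (by positivity)
            · rw [norm_mul, norm_inv, norm_pow, hβ, one_pow, inv_one, one_mul]
              exact hg m hm1
            · rw [norm_mul, norm_inv, Complex.norm_natCast]
              gcongr
              exact hAn m
        _ = 2 * C * ((m : ℝ) * √(m : ℝ))⁻¹ := by
            have : (m : ℝ)⁻¹ = (√(m : ℝ) * √(m : ℝ))⁻¹ := by rw [Real.mul_self_sqrt hm0.le]
            rw [mul_inv (m : ℝ), this]
            field_simp
            ring
  · refine ⟨_, (Summable.of_norm_bounded (summable_inv_mul_sqrt.mul_left C)
      fun n => (norm_coeff_op_le hβ hC n).trans ?_).hasSum.tendsto_sum_nat⟩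
    rcases Nat.eq_zero_or_pos n with rfl | hn
    · simp
    · have h1 : (1 : ℝ) ≤ n := by exact_mod_cast hn
      have h2 : (0 : ℝ) < √(n : ℝ) := Real.sqrt_pos.mpr (by linarith)
      have h3 : ((n : ℝ) ^ s)⁻¹ ≤ ((n : ℝ) * (√(n : ℝ) * √(n : ℝ)))⁻¹ := by
        rw [Real.mul_self_sqrt (by linarith), ← sq]
        exact inv_anti₀ (by positivity) (pow_le_pow_right₀ h1 hs)
      calc ((n : ℝ) ^ s)⁻¹ * (C * √(n : ℝ))
          ≤ ((n : ℝ) * (√(n : ℝ) * √(n : ℝ)))⁻¹ * (C * √(n : ℝ)) := by gcongr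
        _ = C * ((n : ℝ) * √(n : ℝ))⁻¹ := by field_simp

end MultiplePolylog

/-! ### Admissibility and passage to the boundary. -/

namespace MultiplePolylog

open Finset PowerSeries
open MPV (liPartial lambdaPartial theta lambda LambdaConverges IsAdmissible posVectors shufflePairs
  shuffleVec mem_posVectors coeffFactor intChoose)

theorem lambdaConverges_of_isAdmissible {k : ℕ} (hk : 0 < k) {s : Fin k → ℕ} (hs : ∀ i, 1 ≤ s i)
    {b : Fin k → Circle} (hb : IsAdmissible hk s b) : LambdaConverges s b := by
  obtain ⟨k, rfl⟩ : ∃ m, k = m + 1 := ⟨k - 1, by omega⟩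
  have hn : ∀ i, ‖(b i : ℂ)⁻¹‖ = 1 := fun i => by
    rw [norm_inv, Circle.norm_coe, inv_one]
  obtain ⟨C, hC0, hC, hg⟩ := exists_coeff_bound (Fin.tail s) (fun i => hs _)
    (Fin.tail fun i => (b i : ℂ)⁻¹) (fun i => hn _)
  have h1 : ¬ (s 0 = 1 ∧ (b 0 : ℂ)⁻¹ = 1) := fun h =>
    hb (Prod.ext h.1 (Circle.ext (by simpa using h.2)))
  obtain ⟨L, hL⟩ := exists_tendsto_sum_coeff_op (hs 0) (hn 0) h1 hC0 hC hg
  have hT : Tendsto (lambdaPartial s b) atTop (𝓝 L) :=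
    (hL.comp (tendsto_add_atTop_nat 1)).congr fun N => (lambdaPartial_eq s b N).symm
  rwa [LambdaConverges, lambda, hT.limUnder_eq]

theorem tendsto_sum_coeff_of_lambdaConverges {k : ℕ} {s : Fin k → ℕ} {b : Fin k → Circle}
    (h : LambdaConverges s b) :
    Tendsto (fun N => ∑ m ∈ range N, PowerSeries.coeff m (mpSeries s fun i => (b i : ℂ)⁻¹)) atTop
      (𝓝 (lambda s b)) :=
  (tendsto_add_atTop_iff_nat 1).mp (h.congr fun N => lambdaPartial_eq s b N)

theorem merge_inv {k l n : ℕ} {p : (Fin k → Fin n) × (Fin l → Fin n)} (hp : p ∈ shuffles k l n)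
    (a : Fin k → Circle) (b : Fin l → Circle) :
    merge p (fun i => (a i : ℂ)⁻¹) (fun i => (b i : ℂ)⁻¹) = fun i => ((merge p a b i : Circle) : ℂ)⁻¹ :=
  merge_eq hp (fun j => by rw [merge_left hp]) (fun j => by rw [merge_right hp])

/-- If `t₁ = 1`, a nonzero first factor `t₁ - 1` over `h₁ - 1` forces `h₁ = 1`. The first letter of
a shuffle is the first letter of one of the words, whose admissibility then excludes the entry `1`.
-/
theorem isAdmissible_shuffleVec {k l : ℕ} (hk : 0 < k) (hl : 0 < l) {r : Fin k → ℕ}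
    {s : Fin l → ℕ} (hr : ∀ i, 1 ≤ r i) (hs : ∀ i, 1 ≤ s i) {a : Fin k → Circle}
    {b : Fin l → Circle} (ha : IsAdmissible hk r a) (hb : IsAdmissible hl s b)
    {t : Fin (k + l) → ℕ} {p : (Fin k → Fin (k + l)) × (Fin l → Fin (k + l))}
    (hp : p ∈ shufflePairs k l) (hc : MPV.coeff r s t p.1 p.2 ≠ 0) :
    IsAdmissible (Nat.add_pos_left hk l) t (shuffleVec p.1 p.2 a b) := by
  have hp' : p ∈ shuffles k l (k + l) := hp
  obtain ⟨h1, h2, h3, h4⟩ := mem_shuffles.mp hp'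
  set z : Fin (k + l) := ⟨0, Nat.add_pos_left hk l⟩ with hz
  have hf : intChoose (t z - 1) ((merge p r s z : ℕ) - 1) ≠ 0 := by
    have := prod_ne_zero_iff.mp hc z (mem_univ _)
    rwa [coeffFactor, if_pos (Or.inl rfl)] at this
  intro h
  obtain ⟨ht, hv⟩ := Prod.mk.inj h
  have hv : merge p a b z = 1 := hv
  have hm : merge p r s z ≤ 1 := by
    by_contra hlt
    refine hf ?_
    rw [intChoose, if_pos (by omega), Nat.choose_eq_zero_of_lt]
    have ht : t z = 1 := ht
    omega
  rcases h4 z with ⟨i, hi⟩ | ⟨j, hj⟩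
  · have hi0 : p.1 ⟨0, hk⟩ = z := le_antisymm
      ((h1.monotone (Fin.le_def.mpr (Nat.zero_le _))).trans hi.le) (Fin.le_def.mpr (Nat.zero_le _))
    rw [← hi0, merge_left hp'] at hv hm
    exact ha (Prod.ext (le_antisymm hm (hr _)) hv)
  · have hj0 : p.2 ⟨0, hl⟩ = z := le_antisymm
      ((h2.monotone (Fin.le_def.mpr (Nat.zero_le _))).trans hj.le) (Fin.le_def.mpr (Nat.zero_le _))
    rw [← hj0, merge_right hp'] at hv hm
    exact hb (Prod.ext (le_antisymm hm (hs _)) hv)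

theorem summable_norm_coeff_mul_pow {k : ℕ} {s : Fin k → ℕ} (hs : ∀ i, 1 ≤ s i) {β : Fin k → ℂ}
    (hβ : ∀ i, ‖β i‖ = 1) {z : ℂ} (hz : ‖z‖ < 1) :
    Summable fun n => ‖PowerSeries.coeff n (mpSeries s β) * z ^ n‖ := by
  obtain ⟨C, hC0, -, hC⟩ := exists_coeff_bound s hs β hβ
  refine (summable_nat_add_iff 1).mp (Summable.of_nonneg_of_le (fun _ => norm_nonneg _)
    (fun n => ?_) ((summable_nat_add_iff 1).mpr
      ((summable_geometric_of_lt_one (norm_nonneg z) hz).mul_left C)))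
  rw [norm_mul, norm_pow]
  refine mul_le_mul_of_nonneg_right ((hC (n + 1) (by omega)).trans ?_) (by positivity)
  refine mul_le_of_le_one_right hC0 (inv_le_one_of_one_le₀ ?_)
  rw [Real.one_le_sqrt]
  exact_mod_cast Nat.le_add_left 1 n

theorem tsum_coeff_mul {f g : PowerSeries ℂ} {z : ℂ}
    (hf : Summable fun n => ‖PowerSeries.coeff n f * z ^ n‖)
    (hg : Summable fun n => ‖PowerSeries.coeff n g * z ^ n‖) :
    ∑' n, PowerSeries.coeff n (f * g) * z ^ n =
      (∑' n, PowerSeries.coeff n f * z ^ n) * ∑' n, PowerSeries.coeff n g * z ^ n := by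
  rw [tsum_mul_tsum_eq_tsum_sum_antidiagonal_of_summable_norm hf hg]
  refine tsum_congr fun n => ?_
  rw [PowerSeries.coeff_mul, sum_mul]
  refine sum_congr rfl fun x hx => ?_
  rw [← mem_antidiagonal.mp hx, pow_add]
  ring

end MultiplePolylog

theorem mainTheorem5 (k l : ℕ) (hk : 0 < k) (hl : 0 < l)
    (r : Fin k → ℕ) (s : Fin l → ℕ) (hr : ∀ i, 1 ≤ r i) (hs : ∀ i, 1 ≤ s i)
    (a : Fin k → Circle) (b : Fin l → Circle)
    (ha : MPV.IsAdmissible hk r a) (hb : MPV.IsAdmissible hl s b) :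
    MPV.LambdaConverges r a ∧ MPV.LambdaConverges s b ∧
    (∀ t ∈ MPV.posVectors (k + l) (∑ i, r i + ∑ i, s i), ∀ p ∈ MPV.shufflePairs k l,
      MPV.coeff r s t p.1 p.2 ≠ 0 →
        MPV.IsAdmissible (Nat.add_pos_left hk l) t (MPV.shuffleVec p.1 p.2 a b) ∧
        MPV.LambdaConverges t (MPV.shuffleVec p.1 p.2 a b)) ∧
    MPV.lambda r a * MPV.lambda s b =
      ∑ t ∈ MPV.posVectors (k + l) (∑ i, r i + ∑ i, s i), ∑ p ∈ MPV.shufflePairs k l,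
        (MPV.coeff r s t p.1 p.2 : ℂ) * MPV.lambda t (MPV.shuffleVec p.1 p.2 a b) := by
  open MultiplePolylog in
  have hra := lambdaConverges_of_isAdmissible hk hr ha
  have hsb := lambdaConverges_of_isAdmissible hl hs hb
  have hadm : ∀ t ∈ MPV.posVectors (k + l) (∑ i, r i + ∑ i, s i), ∀ p ∈ MPV.shufflePairs k l,
      MPV.coeff r s t p.1 p.2 ≠ 0 →
        MPV.IsAdmissible (Nat.add_pos_left hk l) t (MPV.shuffleVec p.1 p.2 a b) ∧
        MPV.LambdaConverges t (MPV.shuffleVec p.1 p.2 a b) := fun t ht p hp hc => by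
    have h := isAdmissible_shuffleVec hk hl hr hs ha hb hp hc
    exact ⟨h, lambdaConverges_of_isAdmissible _ (MPV.mem_posVectors.mp ht).2 h⟩
  refine ⟨hra, hsb, hadm, ?_⟩
  let S : {n : ℕ} → (Fin n → ℕ) → (Fin n → Circle) → ℂ → ℂ := fun s b z =>
    ∑' n, PowerSeries.coeff n (mpSeries s fun i => (b i : ℂ)⁻¹) * z ^ n
  have habel : ∀ {n : ℕ} {s : Fin n → ℕ} {b : Fin n → Circle}, MPV.LambdaConverges s b →
      Tendsto (S s b) ((𝓝[<] (1 : ℝ)).map Complex.ofReal) (𝓝 (MPV.lambda s b)) := fun h =>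
    Complex.tendsto_tsum_powerSeries_nhdsWithin_lt (tendsto_sum_coeff_of_lambdaConverges h)
  -- Both sides are limits, as `x → 1` from below, of one function, by Abel's theorem.
  refine tendsto_nhds_unique ((habel hra).mul (habel hsb)) ?_
  have hlim : Tendsto (fun z => ∑ t ∈ MPV.posVectors (k + l) (∑ i, r i + ∑ i, s i),
      ∑ p ∈ MPV.shufflePairs k l,
        (MPV.coeff r s t p.1 p.2 : ℂ) * S t (MPV.shuffleVec p.1 p.2 a b) z)
      ((𝓝[<] (1 : ℝ)).map Complex.ofReal)
      (𝓝 (∑ t ∈ MPV.posVectors (k + l) (∑ i, r i + ∑ i, s i), ∑ p ∈ MPV.shufflePairs k l,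
        (MPV.coeff r s t p.1 p.2 : ℂ) * MPV.lambda t (MPV.shuffleVec p.1 p.2 a b))) := by
    refine tendsto_finsetSum _ fun t ht => tendsto_finsetSum _ fun p hp => ?_
    -- If the coefficient is `0`, convergence of the series for `λ` is not available, but the term
    -- is identically `0`.
    by_cases hc : MPV.coeff r s t p.1 p.2 = 0
    · simp only [hc, Nat.cast_zero, zero_mul]
      exact tendsto_const_nhds
    · exact (habel (hadm t ht p hp hc).2).const_mul _
  refine hlim.congr' ?_
  rw [EventuallyEq, eventually_map]
  filter_upwards [Ioo_mem_nhdsLT (zero_lt_one' ℝ)] with x hx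
  have hz : ‖(x : ℂ)‖ < 1 := by
    rw [Complex.norm_real, Real.norm_of_nonneg hx.1.le]
    exact hx.2
  have hsum : ∀ {n : ℕ} {s : Fin n → ℕ}, (∀ i, 1 ≤ s i) → ∀ b : Fin n → Circle,
      Summable fun m => ‖PowerSeries.coeff m (mpSeries s fun i => (b i : ℂ)⁻¹) * (x : ℂ) ^ m‖ :=
    fun hs b => summable_norm_coeff_mul_pow hs (fun i => by rw [norm_inv, Circle.norm_coe, inv_one]) hz
  have hmul := tsum_coeff_mul (hsum hr a) (hsum hs b)
  have hsum' : ∀ t ∈ MPV.posVectors (k + l) (∑ i, r i + ∑ i, s i), ∀ p ∈ MPV.shufflePairs k l,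
      Summable fun n => (MPV.coeff r s t p.1 p.2 : ℂ) * (PowerSeries.coeff n (mpSeries t
        fun i => ((MPV.shuffleVec p.1 p.2 a b i : Circle) : ℂ)⁻¹) * (x : ℂ) ^ n) :=
    fun t ht p _ => ((hsum (MPV.mem_posVectors.mp ht).2 _).of_norm).mul_left _
  have hcoeff : ∀ n, PowerSeries.coeff n (mpSeries r (fun i => (a i : ℂ)⁻¹) *
      mpSeries s fun i => (b i : ℂ)⁻¹) * (x : ℂ) ^ n =
      ∑ t ∈ MPV.posVectors (k + l) (∑ i, r i + ∑ i, s i), ∑ p ∈ MPV.shufflePairs k l,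
        (MPV.coeff r s t p.1 p.2 : ℂ) * (PowerSeries.coeff n (mpSeries t
          fun i => ((MPV.shuffleVec p.1 p.2 a b i : Circle) : ℂ)⁻¹) * (x : ℂ) ^ n) := fun n => by
    rw [mpSeries_mul r s hr hs, map_sum, Finset.sum_mul]
    refine Finset.sum_congr rfl fun t _ => ?_
    rw [map_sum, Finset.sum_mul]
    refine Finset.sum_congr rfl fun p hp => ?_
    rw [merge_inv hp, map_nsmul, nsmul_eq_mul, mul_assoc]
    rfl
  refine Eq.trans ?_ hmul
  rw [tsum_congr hcoeff, Summable.tsum_finsetSum fun t ht => summable_sum (hsum' t ht)]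
  refine Finset.sum_congr rfl fun t ht => ?_
  rw [Summable.tsum_finsetSum (hsum' t ht)]
  exact Finset.sum_congr rfl fun p _ => tsum_mul_left.symm
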